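/- All graphs are finite and simple; the order of a graph is its number of vertices and its size is its number of edges. A graph of order $n$ is edge-pancyclic if for every integer $m$ with $3\le m\le n$ every edge of the graph lies in a cycle of length $m$. Let $f(n)$ be the minimum size of an edge-pancyclic graph of order $n$ that has at least one edge. For an integer $k\ge 3$, let $H(k)$ be the graph consisting of two vertex-disjoint fans, the first with centre $v$ joined to every vertex of the path $v_1v_2\cdots v_{3k-3}$ and the second with centre $u$ joined to every vertex of the path $u_1u_2\cdots u_{3k-3}$, together with the three edges $vu$, $vu_{3k-3}$ and $uv_{3k-3}$. Let $G(k)$ be the graph obtained from a cycle $x_1x_2\cdots x_kx_1$ (with $x_{k+1}=x_1$) by replacing, for each $i$ with $1\le i\le k$, the edge $x_ix_{i+1}$ by a copy of $H(k)$ whose vertices $v_1$ and $u_1$ are identified with $x_i$ and $x_{i+1}$, respectively. **Theorem 5.** Let $k\ge 3$ be an integer and let $n=6k^2-5k$. Then there exists an edge-pancyclic graph of order $n$ and size $2n-k$. In fact, the graph $G(k)$ is edge-pancyclic of order $n$ and size $2n-k$. In particular, $f(n)\le 2n-k$. -/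

import Mathlib

/-- A graph of order `n` is edge-pancyclic if every edge lies in a cycle of length `m`
for every `m` with `3 ≤ m ≤ n`. -/
def SimpleGraph.IsEdgePancyclic {V : Type*} (G : SimpleGraph V) : Prop :=
  ∀ e ∈ G.edgeSet, ∀ m : ℕ, 3 ≤ m → m ≤ Nat.card V →
    ∃ (x : V) (c : G.Walk x x), c.IsCycle ∧ c.length = m ∧ e ∈ c.edges

/-- The minimum size `f(n)` of an edge-pancyclic graph of order `n`. The edgeless graph, for which
the condition is vacuous, does not compete. -/
noncomputable def edgePancyclicMinSize (n : ℕ) : ℕ :=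
  sInf {m : ℕ | ∃ G : SimpleGraph (Fin n),
    G ≠ ⊥ ∧ G.IsEdgePancyclic ∧ G.edgeSet.ncard = m}

/-- The fan of order `s`: the vertex `0` is the centre, and the remaining vertices form the path
`1, 2, …, s - 1`. -/
def fanGraph (s : ℕ) : SimpleGraph (Fin s) :=
  SimpleGraph.fromRel fun a b => a.val = 0 ∨ (1 ≤ a.val ∧ b.val = a.val + 1)

/-- The vertices of the gadget `H(k)`: `(false, 0)` is `v`, `(false, i)` is `v_i`,
`(true, 0)` is `u`, `(true, i)` is `u_i`, for `1 ≤ i ≤ 3k - 3`. -/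
abbrev GadgetVertex (k : ℕ) : Type := Bool × Fin (3 * k - 2)

/-- The gadget `H(k)`: two disjoint fans of order `3k - 2`, joined by the three edges
`v u`, `v u_{3k-3}` and `v_{3k-3} u`. -/
def gadgetGraph (k : ℕ) : SimpleGraph (GadgetVertex k) :=
  SimpleGraph.fromRel fun p q =>
    (p.1 = q.1 ∧ (fanGraph (3 * k - 2)).Adj p.2 q.2) ∨
    (p.1 = false ∧ q.1 = true ∧
      ((p.2.val = 0 ∧ q.2.val = 0) ∨
       (p.2.val = 0 ∧ q.2.val = 3 * k - 3) ∨
       (p.2.val = 3 * k - 3 ∧ q.2.val = 0)))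

/-- The vertices of `G(k)`. There is one copy of `H(k)` for each `j : ZMod k`, and the vertex `u_1`
of copy `j` is the vertex `v_1` of copy `j + 1`; so each copy contributes its vertices other
than `u_1`. -/
abbrev GadgetCycleVertex (k : ℕ) : Type :=
  ZMod k × {p : GadgetVertex k // ¬ (p.1 = true ∧ p.2.val = 1)}

/-- The vertex of `G(k)` that the vertex `p` of the `j`-th copy of `H(k)` becomes. -/
def gadgetCyclePlace (k : ℕ) (j : ZMod k) (p : GadgetVertex k) : GadgetCycleVertex k :=
  if h : p.1 = true ∧ p.2.val = 1 then (j + 1, ⟨(false, p.2), by simp⟩) else (j, ⟨p, h⟩)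

/-- The graph `G(k)`: each edge `x_j x_{j+1}` of a `k`-cycle is replaced by a copy of `H(k)`, in
which `v_1` is identified with `x_j` and `u_1` with `x_{j+1}`. -/
def gadgetCycleGraph (k : ℕ) : SimpleGraph (GadgetCycleVertex k) :=
  SimpleGraph.fromRel fun a b => ∃ (j : ZMod k) (p q : GadgetVertex k),
    (gadgetGraph k).Adj p q ∧ a = gadgetCyclePlace k j p ∧ b = gadgetCyclePlace k j q

/-! Put N = 3k - 3. A copy of H(k) can be crossed from v_1 to u_1 by paths of every length from 3 to
2N + 1 = 6k - 5, the longest being Hamiltonian in the copy. Each edge e of a copy has a length L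
such that e lies in cycles of all lengths from 3 to N + L - 1 inside the copy, and in crossings of
lengths L and 2N + 1; this is `Flexible`.

Crossing the other k - 1 copies adds any length from 3(k - 1) = N to (6k - 5)(k - 1)
(`Traverses.extend`). So cycles round the ring through e start at N + L, exactly where the local
ones stop; this is what the fan size buys. The crossing of length L serves up to L + (6k - 5)(k -
1), and the Hamiltonian one goes on to k(6k - 5) = n.

For the size, copies share vertices but no edges, so there are k(12k - 11) = 2n - k edges. -/

namespace SimpleGraph

/-! ### Paths with recorded vertex region, length and edges -/

variable {V : Type*} {G : SimpleGraph V}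

/-- There is a path from `x` to `y` of length `L` whose vertices all lie in `S` and which uses
all the edges in `E`. -/
def HasPath (G : SimpleGraph V) (S : Set V) (x y : V) (L : ℕ) (E : Set (Sym2 V)) : Prop :=
  ∃ p : G.Walk x y, p.IsPath ∧ p.length = L ∧ (∀ z ∈ p.support, z ∈ S) ∧ ∀ e ∈ E, e ∈ p.edges

/-- The edge `e` lies in a cycle of length `m`. -/
def InCycle (G : SimpleGraph V) (e : Sym2 V) (m : ℕ) : Prop :=
  ∃ (x : V) (c : G.Walk x x), c.IsCycle ∧ c.length = m ∧ e ∈ c.edges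

namespace HasPath

variable {S T : Set V} {x y z w : V} {L M : ℕ} {E F : Set (Sym2 V)}

theorem nil (x : V) : G.HasPath {x} x x 0 ∅ :=
  ⟨Walk.nil, by simp, by simp, by simp, by simp⟩

theorem mono (h : G.HasPath S x y L E) (hS : S ⊆ T) (hF : F ⊆ E) : G.HasPath T x y L F := by
  obtain ⟨p, hp, hl, hs, he⟩ := h
  exact ⟨p, hp, hl, fun z hz => hS (hs z hz), fun e h => he e (hF h)⟩

theorem reverse (h : G.HasPath S x y L E) : G.HasPath S y x L E := by
  obtain ⟨p, hp, hl, hs, he⟩ := h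
  exact ⟨p.reverse, hp.reverse, by simpa using hl, by simpa using hs, by simpa using he⟩

theorem join (h : G.HasPath S x y L E) (hyz : G.Adj y z) (h' : G.HasPath T z w M F)
    (hd : Disjoint S T) : G.HasPath (S ∪ T) x w (L + M + 1) (E ∪ F ∪ {s(y, z)}) := by
  obtain ⟨p, hp, hl, hs, he⟩ := h
  obtain ⟨q, hq, hl', hs', he'⟩ := h'
  refine ⟨p.append (Walk.cons hyz q), ?_, ?_, ?_, ?_⟩
  · rw [Walk.isPath_def, Walk.support_append, Walk.support_cons, List.tail_cons,
      List.nodup_append]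
    refine ⟨hp.support_nodup, hq.support_nodup, ?_⟩
    rintro a ha b hb rfl
    exact Set.disjoint_left.1 hd (hs a ha) (hs' a hb)
  · simp [hl, hl']; ring
  · intro a ha
    rw [Walk.support_append, Walk.support_cons, List.tail_cons, List.mem_append] at ha
    exact ha.imp (hs a) (hs' a)
  · rintro e ((h | h) | rfl)
    · simp [he e h]
    · simp [he' e h]
    · simp

/-- The last vertex of a path can be split off. -/
theorem exists_adj_last (h : G.HasPath S x y (L + 1) E) :
    ∃ w, ∃ F, G.HasPath (S \ {y}) x w L F ∧ G.Adj w y ∧ E ⊆ F ∪ {s(w, y)} := by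
  obtain ⟨p, hp, hl, hs, he⟩ := h.reverse
  cases p with
  | nil => simp at hl
  | @cons _ w _ hyw q =>
    rw [Walk.cons_isPath_iff] at hp
    refine ⟨w, {e | e ∈ q.edges}, HasPath.reverse ⟨q, hp.1, by simpa using hl, ?_, ?_⟩,
      hyw.symm, ?_⟩
    · intro z hz
      refine ⟨hs z (by simp [hz]), ?_⟩
      rintro rfl
      exact hp.2 hz
    · simp
    · intro e h
      have := he e h
      rw [Walk.edges_cons, List.mem_cons, Sym2.eq_swap] at this
      exact this.symm

/-- A path containing the edge between its two ends has length 1, so for L ≥ 2 the closing edge is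
new. -/
theorem inCycle (h : G.HasPath S x y L E) (hyx : G.Adj y x) (hL : 2 ≤ L) {e : Sym2 V}
    (he : e ∈ E ∪ {s(y, x)}) : G.InCycle e (L + 1) := by
  obtain ⟨p, hp, hl, hs, hE⟩ := h
  refine ⟨y, Walk.cons hyx p, ?_, by simp [hl], ?_⟩
  · rw [Walk.cons_isCycle_iff]
    refine ⟨hp, fun hmem => ?_⟩
    rw [Sym2.eq_swap] at hmem
    have := hp.length_eq_one_of_mem_edges hmem
    omega
  · rcases he with he | he
    · simp [hE e he]
    · rw [Set.mem_singleton_iff] at he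
      simp [he]

end HasPath

end SimpleGraph

/-! ### Cycles and crossing paths in two linked fans -/

namespace SimpleGraph

variable {V : Type*} {G : SimpleGraph V}

/-- The map `f` places two disjoint fans in `G`, with centres `f b 0` and paths
`f b 1, …, f b N`, together with the edges that join each centre to the centre and to the last
path vertex of the other fan. -/
structure LinkedFans (G : SimpleGraph V) (N : ℕ) (f : Bool → ℕ → V) : Prop where
  two_le : 2 ≤ N
  inj : ∀ {b c i j}, i ≤ N → j ≤ N → f b i = f c j → b = c ∧ i = j
  spoke : ∀ b {i}, 1 ≤ i → i ≤ N → G.Adj (f b 0) (f b i)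
  rim : ∀ b {i}, 1 ≤ i → i < N → G.Adj (f b i) (f b (i + 1))
  link : ∀ b, G.Adj (f b 0) (f (!b) 0)
  cross : ∀ b, G.Adj (f b N) (f (!b) 0)

namespace LinkedFans

/-- The vertices of a fan with index between `a` and `c`. -/
def seg (f : Bool → ℕ → V) (b : Bool) (a c : ℕ) : Set V := {z | ∃ i, a ≤ i ∧ i ≤ c ∧ z = f b i}

/-- The path edges of a fan between the indices `a` and `c`. -/
def segEdges (f : Bool → ℕ → V) (b : Bool) (a c : ℕ) : Set (Sym2 V) :=
  {e | ∃ i, a ≤ i ∧ i < c ∧ e = s(f b i, f b (i + 1))}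

/-- All vertices of the two fans. -/
def carrier (f : Bool → ℕ → V) (N : ℕ) : Set V := {z | ∃ b i, i ≤ N ∧ z = f b i}

theorem seg_subset_carrier {f : Bool → ℕ → V} {b : Bool} {a c N : ℕ} (h : c ≤ N) :
    seg f b a c ⊆ carrier f N := by
  rintro z ⟨i, -, hi, rfl⟩
  exact ⟨b, i, hi.trans h, rfl⟩

variable {N : ℕ} {f : Bool → ℕ → V} (hf : LinkedFans G N f)
include hf

theorem disjoint_seg {b b' : Bool} {a c a' c' : ℕ} (hc : c ≤ N) (hc' : c' ≤ N)
    (h : b ≠ b' ∨ c < a' ∨ c' < a) : Disjoint (seg f b a c) (seg f b' a' c') := by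
  rw [Set.disjoint_left]
  rintro z ⟨i, h1, h2, rfl⟩ ⟨j, h3, h4, h5⟩
  obtain ⟨rfl, rfl⟩ := hf.inj (by omega) (by omega) h5
  rcases h with h | h | h
  · exact h rfl
  · omega
  · omega

omit hf in
theorem hasPath_point (b : Bool) : G.HasPath (seg f b 0 0) (f b 0) (f b 0) 0 ∅ :=
  (HasPath.nil _).mono (by rintro z rfl; exact ⟨0, le_rfl, le_rfl, rfl⟩) le_rfl

theorem hasPath_seg (b : Bool) {a c : ℕ} (ha : 1 ≤ a) (hac : a ≤ c) (hc : c ≤ N) :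
    G.HasPath (seg f b a c) (f b a) (f b c) (c - a) (segEdges f b a c) := by
  induction c, hac using Nat.le_induction with
  | base =>
    rw [Nat.sub_self]
    refine (HasPath.nil _).mono (by rintro z rfl; exact ⟨a, le_rfl, le_rfl, rfl⟩) ?_
    rintro e ⟨i, h1, h2, -⟩
    omega
  | succ c hac ih =>
    have hp : G.HasPath (seg f b (c + 1) (c + 1)) (f b (c + 1)) (f b (c + 1)) 0 ∅ :=
      (HasPath.nil _).mono (by rintro z rfl; exact ⟨_, le_rfl, le_rfl, rfl⟩) le_rfl
    have := (ih (by omega)).join (hf.rim b (by omega) (by omega)) hp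
      (hf.disjoint_seg (by omega) hc (by omega))
    rw [show c - a + 0 + 1 = c + 1 - a by omega] at this
    refine this.mono ?_ ?_
    · rintro z (⟨i, h1, h2, rfl⟩ | ⟨i, h1, h2, rfl⟩)
      · exact ⟨i, h1, by omega, rfl⟩
      · exact ⟨i, by omega, by omega, rfl⟩
    · rintro e ⟨i, h1, h2, rfl⟩
      rcases Nat.lt_or_ge i c with h | h
      · exact Or.inl (Or.inl ⟨i, h1, h, rfl⟩)
      · obtain rfl : i = c := by omega
        exact Or.inr rfl

/-- The path `v₁ … v_a v u u_c … u₁`. -/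
theorem hasPath_both_centres (b : Bool) {a c : ℕ} (ha : 1 ≤ a) (ha' : a ≤ N) (hc : 1 ≤ c)
    (hc' : c ≤ N) :
    G.HasPath (carrier f N) (f b 1) (f (!b) 1) (a + c + 1)
      (segEdges f b 1 a ∪ {s(f b 0, f b a), s(f b 0, f (!b) 0)}) := by
  have := (((hf.hasPath_seg b le_rfl ha ha').join (hf.spoke b ha ha').symm (hasPath_point b)
    (hf.disjoint_seg ha' (by omega) (by omega))).join (hf.link b) (hasPath_point (!b))
    (by
      rw [Set.disjoint_union_left]
      constructor <;> exact hf.disjoint_seg (by omega) (by omega) (by simp))).join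
    (hf.spoke (!b) hc hc') (hf.hasPath_seg (!b) le_rfl hc hc').reverse
    (by
      simp only [Set.disjoint_union_left]
      refine ⟨⟨?_, ?_⟩, ?_⟩ <;> exact hf.disjoint_seg (by omega) (by omega) (by simp))
  rw [show a - 1 + 0 + 1 + 0 + 1 + (c - 1) + 1 = a + c + 1 by omega] at this
  refine this.mono ?_ ?_
  · simp only [Set.union_subset_iff]
    refine ⟨⟨⟨?_, ?_⟩, ?_⟩, ?_⟩ <;> exact seg_subset_carrier (by omega)
  · rintro e (h | rfl | rfl)
    · simp [h]
    · simp [Sym2.eq_swap (a := f b a)]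
    · simp

/-- The path `v₁ … v_a v v_c … v_N u u_d … u₁`. -/
theorem hasPath_cross (b : Bool) {a c d : ℕ} (ha : 1 ≤ a) (hac : a < c) (hc : c ≤ N) (hd : 1 ≤ d)
    (hd' : d ≤ N) :
    G.HasPath (carrier f N) (f b 1) (f (!b) 1) (N - c + a + d + 2)
      {s(f b 0, f b a), s(f b 0, f b c), s(f b N, f (!b) 0)} := by
  have := ((((hf.hasPath_seg b le_rfl ha (by omega)).join (hf.spoke b ha (by omega)).symm
    (hasPath_point b) (hf.disjoint_seg (by omega) (by omega) (by omega))).join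
    (hf.spoke b (by omega) hc) (hf.hasPath_seg b (by omega) hc le_rfl)
    (by
      rw [Set.disjoint_union_left]
      constructor <;> exact hf.disjoint_seg (by omega) (by omega) (by omega))).join
    (hf.cross b) (hasPath_point (!b))
    (by
      simp only [Set.disjoint_union_left]
      refine ⟨⟨?_, ?_⟩, ?_⟩ <;> exact hf.disjoint_seg (by omega) (by omega) (by simp))).join
    (hf.spoke (!b) hd hd') (hf.hasPath_seg (!b) le_rfl hd hd').reverse
    (by
      simp only [Set.disjoint_union_left]
      refine ⟨⟨⟨?_, ?_⟩, ?_⟩, ?_⟩ <;> exact hf.disjoint_seg (by omega) (by omega) (by simp))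
  rw [show a - 1 + 0 + 1 + (N - c) + 1 + 0 + 1 + (d - 1) + 1 = N - c + a + d + 2 by omega] at this
  refine this.mono ?_ ?_
  · simp only [Set.union_subset_iff]
    refine ⟨⟨⟨⟨?_, ?_⟩, ?_⟩, ?_⟩, ?_⟩ <;> exact seg_subset_carrier (by omega)
  · rintro e (rfl | rfl | rfl)
    · simp [Sym2.eq_swap (a := f b a)]
    · simp
    · simp

/-- The cycle `v v_c … v_t v`. -/
theorem inCycle_fan (b : Bool) {c t : ℕ} (hc : 1 ≤ c) (hct : c < t) (ht : t ≤ N) {e : Sym2 V}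
    (he : e ∈ segEdges f b c t ∪ {s(f b 0, f b c)}) : G.InCycle e (t - c + 2) := by
  have := ((hasPath_point b).join (hf.spoke b hc (by omega)) (hf.hasPath_seg b hc hct.le ht)
    (hf.disjoint_seg (by omega) (by omega) (by omega)))
  rw [show 0 + (t - c) + 1 = t - c + 1 by omega] at this
  refine this.inCycle (hf.spoke b (by omega) ht).symm (by omega) ?_
  rcases he with h | rfl
  · simp [h]
  · simp

/-- The common part of two families of cycles: the centre edge closes it at once, or it continues
through the other fan. -/
theorem hasPath_two_fans (b : Bool) {c : ℕ} (hc : 1 ≤ c) (hcN : c ≤ N) :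
    G.HasPath (seg f b 0 0 ∪ seg f b c N ∪ seg f (!b) 0 0) (f b 0) (f (!b) 0) (N - c + 2)
      (segEdges f b c N ∪ {s(f b 0, f b c), s(f b N, f (!b) 0)}) := by
  have := ((hasPath_point b).join (hf.spoke b hc hcN) (hf.hasPath_seg b hc hcN le_rfl)
    (hf.disjoint_seg (by omega) (by omega) (by omega))).join (hf.cross b) (hasPath_point (!b))
    (by
      simp only [Set.disjoint_union_left]
      refine ⟨?_, ?_⟩ <;> exact hf.disjoint_seg (by omega) (by omega) (by simp))
  rw [show 0 + (N - c) + 1 + 0 + 1 = N - c + 2 by omega] at this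
  refine this.mono le_rfl ?_
  rintro e (h | rfl | rfl)
  · simp [h]
  · simp
  · simp

/-- The cycle `v v_c … v_N u v`. -/
theorem inCycle_link (b : Bool) {c : ℕ} (hc : 1 ≤ c) (hcN : c ≤ N) {e : Sym2 V}
    (he : e ∈ segEdges f b c N ∪
      {s(f b 0, f b c), s(f b N, f (!b) 0), s(f b 0, f (!b) 0)}) :
    G.InCycle e (N - c + 3) := by
  refine (hf.hasPath_two_fans b hc hcN).inCycle (hf.link b).symm (by omega) ?_
  rcases he with h | rfl | rfl | rfl
  · simp [h]
  · simp
  · simp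
  · simp [Sym2.eq_swap (a := f b 0)]

/-- The cycle `v v_c … v_N u u_d … u_N v`. -/
theorem inCycle_two_fans (b : Bool) {c d : ℕ} (hc : 1 ≤ c) (hcN : c ≤ N) (hd : 1 ≤ d)
    (hdN : d ≤ N) {e : Sym2 V}
    (he : e ∈ segEdges f b c N ∪ {s(f b 0, f b c), s(f b N, f (!b) 0)}) :
    G.InCycle e (N - c + (N - d) + 4) := by
  have hd0 : 0 < d := hd
  have := (hf.hasPath_two_fans b hc hcN).join (hf.spoke (!b) hd hdN)
    (hf.hasPath_seg (!b) hd hdN le_rfl)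
    (by
      simp only [Set.disjoint_union_left]
      refine ⟨⟨?_, ?_⟩, ?_⟩ <;> exact hf.disjoint_seg (by omega) (by omega) (by simp [hd0]))
  have hx := hf.cross (!b)
  rw [Bool.not_not] at hx
  rw [show N - c + (N - d) + 4 = N - c + 2 + (N - d) + 1 + 1 by omega]
  exact this.inCycle hx (by omega) (Or.inl (Or.inl (Or.inl he)))

/-- The cycles `v v_c … v_N u v` and `v v_c … v_N u u_d … u_N v` have all lengths from
`N + 3 - c` to `2N + 3 - c`. -/
theorem inCycle_of_le (b : Bool) {c m : ℕ} (hc : 1 ≤ c) (hcN : c ≤ N) (hm : N + 3 ≤ m + c)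
    (hm' : m + c ≤ 2 * N + 3) {e : Sym2 V}
    (he : e ∈ segEdges f b c N ∪ {s(f b 0, f b c), s(f b N, f (!b) 0)}) : G.InCycle e m := by
  rcases hm.eq_or_lt with h | h
  · rw [show m = N - c + 3 by omega]
    refine hf.inCycle_link b hc hcN ?_
    rcases he with h | rfl | rfl
    · simp [h]
    · simp
    · simp
  -- The starting index d = 2N + 4 - c - m in the second fan is solved from the length; the bounds
  -- on m + c say that 1 ≤ d ≤ N.
  · rw [show m = N - c + (N - (2 * N + 4 - c - m)) + 4 by omega]
    exact hf.inCycle_two_fans b hc hcN (by omega) (by omega) he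

omit hf in
/-- The edge `e` lies in enough cycles inside the two fans and in enough paths that cross from one
fan to the other. -/
def Flexible (G : SimpleGraph V) (N : ℕ) (f : Bool → ℕ → V) (b : Bool) (e : Sym2 V) : Prop :=
  ∃ L, 3 ≤ L ∧ L ≤ 2 * N + 1 ∧ (∀ m, 3 ≤ m → m < N + L → G.InCycle e m) ∧
    G.HasPath (carrier f N) (f b 1) (f (!b) 1) L {e} ∧
    G.HasPath (carrier f N) (f b 1) (f (!b) 1) (2 * N + 1) {e}

/-- The cycles entering the fan at index i reach length 2N + 3 - i, which allows any L up to N - i +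
4. For i > 1 this is the length of the crossing v_1 v v_i … v_N u u_1; for i = 1 the crossing v_1 v
u u_1 gives L = 3. -/
theorem flexible_spoke (b : Bool) {i : ℕ} (hi : 1 ≤ i) (hiN : i ≤ N) :
    Flexible G N f b s(f b 0, f b i) := by
  have h2 := hf.two_le
  have hcyc : ∀ m, 3 ≤ m → m + i ≤ 2 * N + 3 → G.InCycle s(f b 0, f b i) m := by
    intro m hm hm'
    rcases Nat.lt_or_ge (m + i) (N + 3) with h | h
    · rw [show m = (m + i - 2) - i + 2 by omega]
      exact hf.inCycle_fan b hi (by omega) (by omega) (by simp)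
    · exact hf.inCycle_of_le b hi hiN h hm' (by simp)
  rcases hi.eq_or_lt with rfl | h
  · refine ⟨3, le_rfl, by omega, fun m hm hm' => hcyc m hm (by omega),
      (hf.hasPath_both_centres b le_rfl hiN le_rfl hiN).mono le_rfl (by simp), ?_⟩
    have := hf.hasPath_cross b (a := 1) (c := 2) (d := N) le_rfl (by omega) h2 hiN le_rfl
    rw [show N - 2 + 1 + N + 2 = 2 * N + 1 by omega] at this
    exact this.mono le_rfl (by simp)
  · refine ⟨N - i + 4, by omega, by omega, fun m hm hm' => hcyc m hm (by omega),
      (hf.hasPath_cross b (a := 1) (c := i) (d := 1) le_rfl h hiN le_rfl (by omega)).mono le_rfl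
        (by simp), ?_⟩
    have := hf.hasPath_cross b (a := i - 1) (c := i) (d := N) (by omega) (by omega) hiN
      (by omega) le_rfl
    rw [show N - i + (i - 1) + N + 2 = 2 * N + 1 by omega] at this
    exact this.mono le_rfl (by simp)

/-- L = i + 3 is the length of the crossing v_1 … v_{i+1} v u u_1. -/
theorem flexible_rim (b : Bool) {i : ℕ} (hi : 1 ≤ i) (hiN : i < N) :
    Flexible G N f b s(f b i, f b (i + 1)) := by
  have hmem : ∀ {c t}, c ≤ i → i < t → s(f b i, f b (i + 1)) ∈ segEdges f b c t :=
    fun h h' => ⟨i, h, h', rfl⟩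
  refine ⟨i + 3, by omega, by omega, ?_, ?_, ?_⟩
  · intro m hm hm'
    rcases Nat.lt_or_ge m (N + 2) with h | h
    -- A fan cycle of length m uses m - 1 consecutive path vertices: the first m - 1 if they include
    -- v_{i+1}, otherwise those ending at v_{i+1}.
    · rcases Nat.lt_or_ge i (m - 1) with h' | h'
      · rw [show m = (m - 1) - 1 + 2 by omega]
        exact hf.inCycle_fan b le_rfl (by omega) (by omega) (Or.inl (hmem hi h'))
      · rw [show m = (i + 1) - (i + 3 - m) + 2 by omega]
        exact hf.inCycle_fan b (by omega) (by omega) (by omega)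
          (Or.inl (hmem (by omega) (by omega)))
    · exact hf.inCycle_of_le b le_rfl (by omega) (by omega) (by omega) (Or.inl (hmem hi hiN))
  · have := hf.hasPath_both_centres b (a := i + 1) (c := 1) (by omega) hiN le_rfl (by omega)
    exact this.mono le_rfl
      (Set.singleton_subset_iff.2 (Or.inl (hmem hi (by omega))))
  · have := hf.hasPath_both_centres b (a := N) (c := N) (by omega) le_rfl (by omega) le_rfl
    rw [← two_mul] at this
    exact this.mono le_rfl (Set.singleton_subset_iff.2 (Or.inl (hmem hi hiN)))

theorem flexible_link (b : Bool) : Flexible G N f b s(f b 0, f (!b) 0) := by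
  have h2 := hf.two_le
  refine ⟨3, le_rfl, by omega, ?_, ?_, ?_⟩
  · intro m hm hm'
    rw [show m = N - (N + 3 - m) + 3 by omega]
    exact hf.inCycle_link b (by omega) (by omega) (by simp)
  · exact (hf.hasPath_both_centres b (a := 1) (c := 1) le_rfl (by omega) le_rfl (by omega)).mono
      le_rfl (by simp)
  · have := hf.hasPath_both_centres b (a := N) (c := N) (by omega) le_rfl (by omega) le_rfl
    rw [← two_mul] at this
    exact this.mono le_rfl (by simp)

theorem flexible_cross (b : Bool) : Flexible G N f b s(f b N, f (!b) 0) := by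
  have h2 := hf.two_le
  refine ⟨4, by omega, by omega, ?_, ?_, ?_⟩
  · intro m hm hm'
    rcases Nat.lt_or_ge m (N + 3) with h | h
    · rw [show m = N - (N + 3 - m) + 3 by omega]
      exact hf.inCycle_link b (by omega) (by omega) (by simp)
    · exact hf.inCycle_of_le b (c := 1) le_rfl (by omega) (by omega) (by omega) (by simp)
  · have := hf.hasPath_cross b (a := 1) (c := N) (d := 1) le_rfl (by omega) le_rfl le_rfl (by omega)
    rw [show N - N + 1 + 1 + 2 = 4 by omega] at this
    exact this.mono le_rfl (by simp)
  · have := hf.hasPath_cross b (a := 1) (c := 2) (d := N) le_rfl (by omega) h2 (by omega) le_rfl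
    rw [show N - 2 + 1 + N + 2 = 2 * N + 1 by omega] at this
    exact this.mono le_rfl (by simp)

omit hf in
-- Swapping the fans only reverses the crossings.
theorem Flexible.false {b : Bool} {e : Sym2 V} (h : Flexible G N f b e) :
    Flexible G N f false e := by
  cases b with
  | false => exact h
  | true =>
    obtain ⟨L, h1, h2, h3, h4, h5⟩ := h
    exact ⟨L, h1, h2, h3, h4.reverse, h5.reverse⟩

/-- The two fans can be crossed by paths of all lengths from `3` to `2N + 1`. -/
theorem hasPath_of_le {M : ℕ} (h3 : 3 ≤ M) (hM : M ≤ 2 * N + 1) :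
    G.HasPath (carrier f N) (f false 1) (f true 1) M ∅ := by
  rcases Nat.lt_or_ge M (N + 2) with h | h
  · have := hf.hasPath_both_centres false (a := M - 2) (c := 1) (by omega) (by omega) le_rfl
      (by omega)
    rw [show M - 2 + 1 + 1 = M by omega] at this
    exact this.mono le_rfl (by simp)
  · have := hf.hasPath_both_centres false (a := N) (c := M - N - 1) (by omega) le_rfl (by omega)
      (by omega)
    rw [show N + (M - N - 1) + 1 = M by omega] at this
    exact this.mono le_rfl (by simp)

end LinkedFans

end SimpleGraph

/-! ### Order and size of G(k) -/

namespace GadgetCycle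

open SimpleGraph

variable {k : ℕ}

/-- The vertex of `H(k)` with index `i ≤ 3k - 3` in the fan `b`. -/
def fanVertex (hk : 3 ≤ k) (b : Bool) (i : ℕ) : GadgetVertex k :=
  (b, ⟨min i (3 * k - 3), by omega⟩)

theorem fanVertex_inj (hk : 3 ≤ k) {b c : Bool} {i j : ℕ} (hi : i ≤ 3 * k - 3)
    (hj : j ≤ 3 * k - 3) : fanVertex hk b i = fanVertex hk c j ↔ b = c ∧ i = j := by
  simp [fanVertex, hi, hj]

theorem exists_eq_fanVertex (hk : 3 ≤ k) (p : GadgetVertex k) :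
    ∃ b i, i ≤ 3 * k - 3 ∧ p = fanVertex hk b i := by
  obtain ⟨b, i, hi⟩ := p
  exact ⟨b, i, by omega, by simp [fanVertex]; omega⟩

theorem fanGraph_adj {s : ℕ} {a b : Fin s} :
    (fanGraph s).Adj a b ↔ a ≠ b ∧ ((a.val = 0 ∨ (1 ≤ a.val ∧ b.val = a.val + 1)) ∨
      (b.val = 0 ∨ (1 ≤ b.val ∧ a.val = b.val + 1))) :=
  SimpleGraph.fromRel_adj _ _ _

theorem gadgetGraph_adj {p q : GadgetVertex k} :
    (gadgetGraph k).Adj p q ↔ p ≠ q ∧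
      (((p.1 = q.1 ∧ (fanGraph (3 * k - 2)).Adj p.2 q.2) ∨ (p.1 = false ∧ q.1 = true ∧
        ((p.2.val = 0 ∧ q.2.val = 0) ∨ (p.2.val = 0 ∧ q.2.val = 3 * k - 3) ∨
          (p.2.val = 3 * k - 3 ∧ q.2.val = 0)))) ∨
      ((q.1 = p.1 ∧ (fanGraph (3 * k - 2)).Adj q.2 p.2) ∨ (q.1 = false ∧ p.1 = true ∧
        ((q.2.val = 0 ∧ p.2.val = 0) ∨ (q.2.val = 0 ∧ p.2.val = 3 * k - 3) ∨
          (q.2.val = 3 * k - 3 ∧ p.2.val = 0))))) :=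
  SimpleGraph.fromRel_adj _ _ _

theorem gadgetGraph_adj_fanVertex (hk : 3 ≤ k) {b c : Bool} {i j : ℕ} (hi : i ≤ 3 * k - 3)
    (hj : j ≤ 3 * k - 3) :
    (gadgetGraph k).Adj (fanVertex hk b i) (fanVertex hk c j) ↔
      (b = c ∧ ((i = 0 ∧ 1 ≤ j) ∨ (j = 0 ∧ 1 ≤ i) ∨ (1 ≤ i ∧ j = i + 1) ∨ (1 ≤ j ∧ i = j + 1))) ∨
      (b ≠ c ∧ ((i = 0 ∧ j = 0) ∨ (i = 0 ∧ j = 3 * k - 3) ∨ (i = 3 * k - 3 ∧ j = 0))) := by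
  rw [gadgetGraph_adj, Ne, fanVertex_inj hk hi hj, fanGraph_adj, fanGraph_adj]
  simp only [fanVertex, ne_eq, Fin.mk.injEq, min_eq_left hi, min_eq_left hj]
  cases b <;> cases c <;> simp <;> omega

/-- Labels for the edges of `H(k)`: spokes, path edges and an edge from the end of the path to the
opposite centre, for each fan, and the edge between the centres. -/
abbrev EdgeLabel (k : ℕ) : Type :=
  (Bool × (Fin (3 * k - 3) ⊕ Fin (3 * k - 4) ⊕ Unit)) ⊕ Unit

/-- The edge of `H(k)` with a given label. -/
def gadgetEdge (hk : 3 ≤ k) : EdgeLabel k → Sym2 (GadgetVertex k)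
  | .inl (b, .inl i) => s(fanVertex hk b 0, fanVertex hk b (i + 1))
  | .inl (b, .inr (.inl i)) => s(fanVertex hk b (i + 1), fanVertex hk b (i + 1 + 1))
  | .inl (b, .inr (.inr _)) => s(fanVertex hk b (3 * k - 3), fanVertex hk (!b) 0)
  | .inr _ => s(fanVertex hk false 0, fanVertex hk true 0)

theorem gadgetEdge_injective (hk : 3 ≤ k) : Function.Injective (gadgetEdge hk) := by
  have key : ∀ {b c b' c' : Bool} {i j i' j' : ℕ}, i ≤ 3 * k - 3 → j ≤ 3 * k - 3 →
      i' ≤ 3 * k - 3 → j' ≤ 3 * k - 3 →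
      s(fanVertex hk b i, fanVertex hk c j) = s(fanVertex hk b' i', fanVertex hk c' j') →
      (b = b' ∧ i = i' ∧ c = c' ∧ j = j') ∨ (b = c' ∧ i = j' ∧ c = b' ∧ j = i') := by
    intro b c b' c' i j i' j' h1 h2 h3 h4 h
    rw [Sym2.eq_iff, fanVertex_inj hk h1 h3, fanVertex_inj hk h2 h4, fanVertex_inj hk h1 h4,
      fanVertex_inj hk h2 h3] at h
    tauto
  rintro (⟨b, ⟨i, hi⟩ | ⟨i, hi⟩ | u⟩ | u) (⟨c, ⟨j, hj⟩ | ⟨j, hj⟩ | u'⟩ | u') h <;>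
    have h' := key (by simp <;> omega) (by simp <;> omega) (by simp <;> omega)
      (by simp <;> omega) h <;> clear h <;>
    simp at h' ⊢ <;> grind

theorem range_gadgetEdge (hk : 3 ≤ k) :
    Set.range (gadgetEdge hk) = (gadgetGraph k).edgeSet := by
  apply Set.Subset.antisymm
  · rintro _ ⟨(⟨b, ⟨i, hi⟩ | ⟨i, hi⟩ | u⟩ | u), rfl⟩ <;>
      simp only [gadgetEdge, mem_edgeSet] <;>
      rw [gadgetGraph_adj_fanVertex hk (by omega) (by omega)] <;> simp
  · have key : ∀ b c i j, i ≤ 3 * k - 3 → j ≤ 3 * k - 3 → i ≤ j →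
        (gadgetGraph k).Adj (fanVertex hk b i) (fanVertex hk c j) →
        s(fanVertex hk b i, fanVertex hk c j) ∈ Set.range (gadgetEdge hk) := by
      intro b c i j hi hj hij h
      rw [gadgetGraph_adj_fanVertex hk hi hj] at h
      rcases h with ⟨rfl, h⟩ | ⟨hbc, h⟩
      · rcases Nat.eq_zero_or_pos i with rfl | hi0
        · exact ⟨.inl (b, .inl ⟨j - 1, by omega⟩), by
            simp only [gadgetEdge]; rw [Nat.sub_add_cancel (by omega)]⟩
        · obtain rfl : j = i + 1 := by omega
          exact ⟨.inl (b, .inr (.inl ⟨i - 1, by omega⟩)), by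
            simp only [gadgetEdge]; rw [Nat.sub_add_cancel (by omega)]⟩
      · obtain rfl : b = !c := by revert hbc; cases b <;> cases c <;> simp
        obtain rfl : i = 0 := by omega
        rcases Nat.eq_zero_or_pos j with rfl | hj0
        · refine ⟨.inr (), ?_⟩
          cases c
          · exact Sym2.eq_swap
          · rfl
        · obtain rfl : j = 3 * k - 3 := by omega
          exact ⟨.inl (c, .inr (.inr ())), Sym2.eq_swap⟩
    intro e
    induction e using Sym2.ind with
    | _ p q =>
      intro h
      obtain ⟨b, i, hi, rfl⟩ := exists_eq_fanVertex hk p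
      obtain ⟨c, j, hj, rfl⟩ := exists_eq_fanVertex hk q
      rw [mem_edgeSet] at h
      rcases le_total i j with hij | hij
      · exact key b c i j hi hj hij h
      · rw [Sym2.eq_swap]
        exact key c b j i hj hi hij h.symm

theorem card_edgeSet_gadgetGraph (hk : 3 ≤ k) :
    Nat.card (gadgetGraph k).edgeSet = 12 * k - 11 := by
  rw [← range_gadgetEdge hk, Nat.card_range_of_injective (gadgetEdge_injective hk)]
  simp only [Nat.card_eq_fintype_card, Fintype.card_sum, Fintype.card_prod, Fintype.card_bool,
    Fintype.card_fin, Fintype.card_unit]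
  omega

theorem place_eq_place (hk : 3 ≤ k) {j j' : ZMod k} {p p' : GadgetVertex k}
    (h : gadgetCyclePlace k j p = gadgetCyclePlace k j' p') :
    (j = j' ∧ p = p') ∨
      (j' = j + 1 ∧ p = fanVertex hk true 1 ∧ p' = fanVertex hk false 1) ∨
      (j = j' + 1 ∧ p = fanVertex hk false 1 ∧ p' = fanVertex hk true 1) := by
  have h1 : min 1 (3 * k - 3) = 1 := by omega
  obtain ⟨b, i, hi⟩ := p
  obtain ⟨b', i', hi'⟩ := p'
  unfold gadgetCyclePlace at h
  simp only [fanVertex, h1, Prod.mk.injEq, Fin.mk.injEq]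
  split_ifs at h with hp hp' hp' <;> simp at h hp hp' <;> grind

theorem add_one_ne_self (hk : 3 ≤ k) (j : ZMod k) : j + 1 ≠ j := by
  have : Fact (1 < k) := ⟨by omega⟩
  simp

theorem place_injective (hk : 3 ≤ k) (j : ZMod k) :
    Function.Injective (gadgetCyclePlace k j) := by
  intro p q h
  rcases place_eq_place hk h with h | h | h
  · exact h.2
  · exact absurd h.1.symm (add_one_ne_self hk j)
  · exact absurd h.1.symm (add_one_ne_self hk j)

theorem gadgetCycleGraph_adj (hk : 3 ≤ k) {a b : GadgetCycleVertex k} :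
    (gadgetCycleGraph k).Adj a b ↔ ∃ (j : ZMod k) (p q : GadgetVertex k),
      (gadgetGraph k).Adj p q ∧ a = gadgetCyclePlace k j p ∧ b = gadgetCyclePlace k j q := by
  rw [gadgetCycleGraph, fromRel_adj]
  constructor
  · rintro ⟨-, h | ⟨j, p, q, h, ha, hb⟩⟩
    · exact h
    · exact ⟨j, q, p, h.symm, hb, ha⟩
  · intro h
    refine ⟨?_, Or.inl h⟩
    obtain ⟨j, p, q, h, rfl, rfl⟩ := h
    exact fun he => h.ne (place_injective hk j he)

/-- The copy of `H(k)` with index `j` inside `G(k)`. -/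
def placeHom (hk : 3 ≤ k) (j : ZMod k) : gadgetGraph k →g gadgetCycleGraph k where
  toFun := gadgetCyclePlace k j
  map_rel' h := (gadgetCycleGraph_adj hk).2 ⟨j, _, _, h, rfl, rfl⟩

/-- An edge common to two copies would have both ends among the glued vertices v_1 and u_1 of its
copy, but these are not adjacent in H(k). -/
theorem card_edgeSet_gadgetCycleGraph (hk : 3 ≤ k) :
    Nat.card (gadgetCycleGraph k).edgeSet = k * (12 * k - 11) := by
  have hbij : Function.Bijective (fun x : ZMod k × (gadgetGraph k).edgeSet =>
      (placeHom hk x.1).mapEdgeSet x.2) := by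
    constructor
    · rintro ⟨j, e, he⟩ ⟨j', e', he'⟩ h
      obtain rfl : j = j' := by
        have h' := congrArg Subtype.val h
        simp only [Hom.mapEdgeSet] at h'
        induction e using Sym2.ind with
        | _ p q =>
        induction e' using Sym2.ind with
        | _ p' q' =>
          rw [mem_edgeSet] at he
          have hn : ¬ (gadgetGraph k).Adj (fanVertex hk true 1) (fanVertex hk false 1) := by
            rw [gadgetGraph_adj_fanVertex hk (by omega) (by omega)]
            simp
          have hpq : p ≠ q := he.ne
          have hn' : ¬ (gadgetGraph k).Adj (fanVertex hk false 1) (fanVertex hk true 1) :=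
            fun h => hn h.symm
          rcases Sym2.eq_iff.1 h' with ⟨h1, h2⟩ | ⟨h1, h2⟩ <;>
          rcases place_eq_place hk h1 with ⟨h3, h4⟩ | ⟨h3, h4, h5⟩ | ⟨h3, h4, h5⟩ <;>
          first
          | exact h3
          | rcases place_eq_place hk h2 with ⟨h6, h7⟩ | ⟨h6, h7, h8⟩ | ⟨h6, h7, h8⟩
            · exact h6
            all_goals
              subst h4
              subst h7
              first
              | exact absurd rfl hpq
              | exact absurd he hn
              | exact absurd he hn'
      simpa using Hom.mapEdgeSet.injective (placeHom hk j) (place_injective hk j) h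
    · rintro ⟨e, he⟩
      induction e using Sym2.ind with
      | _ a b =>
        obtain ⟨j, p, q, h, rfl, rfl⟩ := (gadgetCycleGraph_adj hk).1 he
        exact ⟨(j, ⟨s(p, q), h⟩), rfl⟩
  rw [← Nat.card_eq_of_bijective _ hbij, Nat.card_prod, Nat.card_zmod, card_edgeSet_gadgetGraph hk]

theorem card_gadgetCycleVertex (hk : 3 ≤ k) :
    Nat.card (GadgetCycleVertex k) = k * (6 * k - 5) := by
  have h : Nat.card {p : GadgetVertex k // ¬ (p.1 = true ∧ p.2.val = 1)} = 6 * k - 5 := by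
    have h1 : ∀ p : GadgetVertex k, (p.1 = true ∧ p.2.val = 1) ↔ p = fanVertex hk true 1 := by
      rintro ⟨b, i, hi⟩
      simp [fanVertex, show min 1 (3 * k - 3) = 1 by omega]
    simp only [h1]
    rw [Nat.card_eq_fintype_card, Fintype.card_subtype_compl, Fintype.card_subtype_eq,
      Fintype.card_prod, Fintype.card_bool, Fintype.card_fin]
    omega
  rw [Nat.card_prod, Nat.card_zmod, h]

/-! ### Cycles around the ring of gadgets -/

/-- The vertices of the copy of `H(k)` with index `j` inside `G(k)`. -/
def cycleVertex (hk : 3 ≤ k) (j : ZMod k) (b : Bool) (i : ℕ) : GadgetCycleVertex k :=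
  gadgetCyclePlace k j (fanVertex hk b i)

theorem linkedFans (hk : 3 ≤ k) (j : ZMod k) :
    LinkedFans (gadgetCycleGraph k) (3 * k - 3) (cycleVertex hk j) where
  two_le := by omega
  inj hi hj h := (fanVertex_inj hk hi hj).1 (place_injective hk j h)
  spoke b i hi hi' := (placeHom hk j).map_adj (by
    rw [gadgetGraph_adj_fanVertex hk (by omega) hi']; simp; omega)
  rim b i hi hi' := (placeHom hk j).map_adj (by
    rw [gadgetGraph_adj_fanVertex hk (by omega) (by omega)]; simp; omega)
  link b := (placeHom hk j).map_adj (by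
    rw [gadgetGraph_adj_fanVertex hk (by omega) (by omega)]; simp)
  cross b := (placeHom hk j).map_adj (by
    rw [gadgetGraph_adj_fanVertex hk (by omega) (by omega)]; simp)

theorem cycleVertex_true_one (hk : 3 ≤ k) (j : ZMod k) :
    cycleVertex hk j true 1 = cycleVertex hk (j + 1) false 1 := by
  simp [cycleVertex, gadgetCyclePlace, fanVertex, show min 1 (3 * k - 3) = 1 by omega]

theorem carrier_diff_subset (hk : 3 ≤ k) (j : ZMod k) :
    LinkedFans.carrier (cycleVertex hk j) (3 * k - 3) \ {cycleVertex hk j true 1} ⊆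
      {a | a.1 = j} := by
  rintro _ ⟨⟨b, i, hi, rfl⟩, hne⟩
  have : ¬ (b = true ∧ i = 1) := by
    rintro ⟨rfl, rfl⟩
    exact hne rfl
  simp [cycleVertex, gadgetCyclePlace, fanVertex, min_eq_left hi, this]

theorem flexible_of_mem_edgeSet (hk : 3 ≤ k) {e : Sym2 (GadgetCycleVertex k)}
    (he : e ∈ (gadgetCycleGraph k).edgeSet) :
    ∃ j, LinkedFans.Flexible (gadgetCycleGraph k) (3 * k - 3) (cycleVertex hk j) false e := by
  induction e using Sym2.ind with
  | _ a b =>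
    obtain ⟨j, p, q, h, rfl, rfl⟩ := (gadgetCycleGraph_adj hk).1 he
    refine ⟨j, ?_⟩
    rw [← mem_edgeSet, ← range_gadgetEdge hk] at h
    obtain ⟨l, hl⟩ := h
    have hF := linkedFans hk j
    change LinkedFans.Flexible _ _ _ _ (Sym2.map (gadgetCyclePlace k j) s(p, q))
    rw [← hl]
    rcases l with ⟨b, ⟨i, hi⟩ | ⟨i, hi⟩ | u⟩ | u
    · exact (hF.flexible_spoke b (by omega) (by omega)).false
    · exact (hF.flexible_rim b (by omega) (by omega)).false
    · exact (hF.flexible_cross b).false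
    · exact hF.flexible_link false

/-- There is a path of length `L` through the edges in `E` that runs through the copies
`j, …, j + r - 1` of `H(k)`, from the first vertex of the copy `j` to the first vertex of the
copy `j + r`; the end vertex is treated separately, since it may agree with the first vertex. -/
def Traverses (hk : 3 ≤ k) (j : ZMod k) (r L : ℕ) (E : Set (Sym2 (GadgetCycleVertex k))) : Prop :=
  ∃ w L' F, (gadgetCycleGraph k).HasPath {a | ∃ i < r, a.1 = j + (i : ℕ)}
      (cycleVertex hk j false 1) w L' F ∧
    (gadgetCycleGraph k).Adj w (cycleVertex hk (j + r) false 1) ∧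
    E ⊆ F ∪ {s(w, cycleVertex hk (j + r) false 1)} ∧ L = L' + 1

/-- Only the final vertex u_1 belongs to the next copy; without it the crossing stays in first
coordinate j. -/
theorem Traverses.of_hasPath {hk : 3 ≤ k} {j : ZMod k} {L : ℕ}
    {E : Set (Sym2 (GadgetCycleVertex k))} (hL : 1 ≤ L)
    (h : (gadgetCycleGraph k).HasPath (LinkedFans.carrier (cycleVertex hk j) (3 * k - 3))
      (cycleVertex hk j false 1) (cycleVertex hk j true 1) L E) : Traverses hk j 1 L E := by
  obtain ⟨L, rfl⟩ := Nat.exists_eq_add_of_le' hL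
  obtain ⟨w, F, hp, hw, hE⟩ := h.exists_adj_last
  refine ⟨w, L, F, hp.mono ?_ le_rfl, ?_, ?_, rfl⟩
  · refine (carrier_diff_subset hk j).trans ?_
    rintro a rfl
    exact ⟨0, by simp⟩
  · simpa [cycleVertex_true_one] using hw
  · simpa [cycleVertex_true_one] using hE

/-- As r < k, the index j + r differs modulo k from all earlier ones, so the new copy is disjoint
from the path so far. -/
theorem Traverses.append {hk : 3 ≤ k} {j : ZMod k} {r L M : ℕ}
    {E F : Set (Sym2 (GadgetCycleVertex k))} (hr : r < k) (h : Traverses hk j r L E)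
    (h' : Traverses hk (j + r) 1 M F) : Traverses hk j (r + 1) (L + M) E := by
  obtain ⟨w, L, E', hp, hw, hE, rfl⟩ := h
  obtain ⟨z, M, F', hp', hz, -, rfl⟩ := h'
  have hj : j + ((r + 1 : ℕ) : ZMod k) = j + r + (1 : ℕ) := by push_cast; ring
  have hd : Disjoint {a : GadgetCycleVertex k | ∃ i < r, a.1 = j + (i : ℕ)}
      {a | ∃ i < 1, a.1 = j + r + (i : ℕ)} := by
    rw [Set.disjoint_left]
    rintro a ⟨i, hi, h1⟩ ⟨i', hi', h2⟩
    obtain rfl : i' = 0 := by omega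
    rw [h1, Nat.cast_zero, add_zero, add_right_inj, ZMod.natCast_eq_natCast_iff',
      Nat.mod_eq_of_lt (by omega), Nat.mod_eq_of_lt hr] at h2
    omega
  refine ⟨z, _, _, (hp.join hw hp' hd).mono ?_ le_rfl, ?_, ?_, by omega⟩
  · rintro a (⟨i, hi, h1⟩ | ⟨i, hi, h1⟩)
    · exact ⟨i, by omega, h1⟩
    · obtain rfl : i = 0 := by omega
      exact ⟨r, by omega, by simpa using h1⟩
  · rwa [hj]
  · refine hE.trans ?_
    rintro e (h | h)
    · exact Or.inl (Or.inl (Or.inl h))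
    · exact Or.inl (Or.inr h)

/-- After k copies j + k = j, so the held-back last edge returns to the start and closes the cycle.
-/
theorem Traverses.inCycle {hk : 3 ≤ k} {j : ZMod k} {L : ℕ}
    {E : Set (Sym2 (GadgetCycleVertex k))} (h : Traverses hk j k L E) (hL : 3 ≤ L)
    {e : Sym2 (GadgetCycleVertex k)} (he : e ∈ E) : (gadgetCycleGraph k).InCycle e L := by
  obtain ⟨w, L, E', hp, hw, hE, rfl⟩ := h
  rw [CharP.cast_eq_zero, add_zero] at hw hE
  exact hp.inCycle hw (by omega) (hE he)

theorem traverses_one (hk : 3 ≤ k) (j : ZMod k) {M : ℕ} (h3 : 3 ≤ M) (hM : M ≤ 6 * k - 5) :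
    Traverses hk j 1 M ∅ :=
  .of_hasPath (by omega) ((linkedFans hk j).hasPath_of_le h3 (by omega))

theorem Traverses.extend {hk : 3 ≤ k} {j : ZMod k} {L : ℕ}
    {E : Set (Sym2 (GadgetCycleVertex k))} (h : Traverses hk j 1 L E) (r : ℕ) (hr : r < k)
    {M : ℕ} (h3 : 3 * r ≤ M) (hM : M ≤ (6 * k - 5) * r) : Traverses hk j (r + 1) (L + M) E := by
  induction r generalizing M with
  | zero =>
    obtain rfl : M = 0 := by omega
    exact h
  | succ r ih =>
    obtain ⟨M₁, M₂, rfl, h1, h2, h3, h4⟩ : ∃ M₁ M₂, M = M₁ + M₂ ∧ 3 * r ≤ M₁ ∧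
        M₁ ≤ (6 * k - 5) * r ∧ 3 ≤ M₂ ∧ M₂ ≤ 6 * k - 5 := by
      have hle : 3 * r ≤ (6 * k - 5) * r := Nat.mul_le_mul_right r (by omega)
      rw [mul_add, mul_one] at h3 hM
      generalize (6 * k - 5) * r = B at *
      -- Give the last copy the minimum 3 if the earlier r copies can absorb the rest; otherwise
      -- fill those to their maximum B.
      rcases Nat.le_total (M - 3) B with h | h
      · exact ⟨M - 3, 3, by omega, by omega, h, le_rfl, by omega⟩
      · exact ⟨B, M - B, by omega, hle, le_rfl, by omega, by omega⟩
    rw [← add_assoc]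
    exact (ih (by omega) h1 h2).append hr (traverses_one hk _ h3 h4)

theorem isEdgePancyclic_gadgetCycleGraph (hk : 3 ≤ k) :
    (gadgetCycleGraph k).IsEdgePancyclic := by
  intro e he m hm hm'
  rw [card_gadgetCycleVertex hk] at hm'
  obtain ⟨j, L, hL, hL', hcyc, hp, hq⟩ := flexible_of_mem_edgeSet hk he
  change (gadgetCycleGraph k).InCycle e m
  have hring : ∀ {L M}, Traverses hk j 1 L {e} → 3 ≤ L → 3 * (k - 1) ≤ M →
      M ≤ (6 * k - 5) * (k - 1) → (gadgetCycleGraph k).InCycle e (L + M) := by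
    intro L M h h3 hM hM'
    have := h.extend (k - 1) (by omega) hM hM'
    rw [Nat.sub_add_cancel (by omega)] at this
    exact this.inCycle (by omega) rfl
  have hmul : k * (6 * k - 5) = (6 * k - 5) * (k - 1) + (6 * k - 5) := by
    obtain ⟨r, rfl⟩ := Nat.exists_eq_add_of_le' (show 1 ≤ k by omega)
    rw [Nat.add_sub_cancel]; ring
  -- Here k ≥ 3 makes the two ranges of ring cycles overlap: past L + (6k - 5)(k - 1), removing a
  -- Hamiltonian crossing leaves at least 3(k - 1).
  have hlarge : (6 * k - 5) * 2 ≤ (6 * k - 5) * (k - 1) := Nat.mul_le_mul_left _ (by omega)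
  rcases Nat.lt_or_ge m (3 * k - 3 + L) with h | h
  · exact hcyc m hm h
  rcases Nat.le_total m (L + (6 * k - 5) * (k - 1)) with h' | h'
  · rw [show m = L + (m - L) by omega]
    exact hring (.of_hasPath (by omega) hp) hL (by omega) (by omega)
  · rw [show m = 2 * (3 * k - 3) + 1 + (m - (6 * k - 5)) by omega]
    exact hring (.of_hasPath (by omega) hq) (by omega) (by omega) (by omega)

end GadgetCycle

/-! ### Transport to `Fin n` and conclusion -/

theorem SimpleGraph.IsEdgePancyclic.of_iso {V W : Type*} {G : SimpleGraph V} {G' : SimpleGraph W}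
    (φ : G ≃g G') (h : G.IsEdgePancyclic) : G'.IsEdgePancyclic := by
  intro e he m hm hm'
  obtain ⟨x, c, hc, hl, hec⟩ := h (Sym2.map φ.symm e)
    (φ.symm.toHom.mapEdgeSet ⟨e, he⟩).2 m hm (by rwa [Nat.card_congr φ.toEquiv])
  refine ⟨_, c.map φ.toHom, hc.map φ.injective, by simpa using hl, ?_⟩
  rw [Walk.edges_map, List.mem_map]
  refine ⟨_, hec, ?_⟩
  rw [Sym2.map_map]
  induction e using Sym2.ind with
  | _ a b => simp

theorem theorem5 (k n : ℕ) (hk : 3 ≤ k) (hn : n = 6 * k ^ 2 - 5 * k) :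
    (∃ G : SimpleGraph (Fin n), G.IsEdgePancyclic ∧ G.edgeSet.ncard = 2 * n - k) ∧
    (Nat.card (GadgetCycleVertex k) = n ∧
      (gadgetCycleGraph k).edgeSet.ncard = 2 * n - k ∧
      (gadgetCycleGraph k).IsEdgePancyclic) ∧
    edgePancyclicMinSize n ≤ 2 * n - k := by
  have hn' : n = k * (6 * k - 5) := by
    rw [hn, Nat.mul_sub]; ring_nf
  have hsize : k * (12 * k - 11) = 2 * n - k := by
    rw [hn', Nat.mul_sub, Nat.mul_sub, Nat.mul_sub]
    have : k * 1 ≤ k * k := Nat.mul_le_mul_left _ (by omega)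
    rw [show k * (12 * k) = 12 * (k * k) by ring, show k * (6 * k) = 6 * (k * k) by ring]
    omega
  have hcard : Nat.card (GadgetCycleVertex k) = n := by
    rw [GadgetCycle.card_gadgetCycleVertex hk, hn']
  have hedges : (gadgetCycleGraph k).edgeSet.ncard = 2 * n - k := by
    rw [← Nat.card_coe_set_eq, GadgetCycle.card_edgeSet_gadgetCycleGraph hk, hsize]
  have hpan := GadgetCycle.isEdgePancyclic_gadgetCycleGraph hk
  have hpos : 0 < 2 * n - k := by
    rw [← hsize]
    exact Nat.mul_pos (by omega) (by omega)
  have : Finite (GadgetCycleVertex k) := Nat.finite_of_card_ne_zero (by omega)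
  let σ : GadgetCycleVertex k ≃ Fin n := Finite.equivFinOfCardEq hcard
  let φ : gadgetCycleGraph k ≃g (gadgetCycleGraph k).map σ.toEmbedding :=
    SimpleGraph.Iso.map σ _
  have hpan' := hpan.of_iso φ
  have hedges' : ((gadgetCycleGraph k).map σ.toEmbedding).edgeSet.ncard = 2 * n - k := by
    rw [← hedges, ← Nat.card_coe_set_eq, ← Nat.card_coe_set_eq, Nat.card_congr φ.mapEdgeSet]
  refine ⟨⟨_, hpan', hedges'⟩, ⟨hcard, hedges, hpan⟩, Nat.sInf_le ⟨_, ?_, hpan', hedges'⟩⟩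
  -- The positive size rules out the edgeless graph.
  intro h
  rw [h] at hedges'
  simp at hedges'
  omega
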